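/- Let $n\in\mathbb{N}$, $0<s<1$ and $1<p<\infty$ satisfy $sp<n$, and let $G\subsetneq\mathbb{R}^n$ be a proper open subset. For $E\subset\mathbb{R}^n$ and $\lambda>0$ let $$\mathcal{H}^\lambda_\infty(E)=\inf\Big\{\sum_{i=1}^\infty r_i^\lambda : E\subset\bigcup_{i=1}^\infty B(x_i,r_i),\ r_i>0\Big\}$$ be the $\lambda$-Hausdorff content of $E$, where $B(x,r)$ is the open ball. For $c\ge 1$, an open and connected set $U\subsetneq\mathbb{R}^n$ is called a $c$-John domain with center point $x_0$ if for every $x\in U$ there is a curve $\gamma\colon[0,\ell]\to U$, parametrized by arc length, such that $\gamma(0)=x$, $\gamma(\ell)=x_0$ and $\operatorname{dist}(\gamma(t),\partial U)\ge t/c$ for all $t\in[0,\ell]$. For $x\in G$ let $G_{x,c}$ be the union of all $c$-John domains $U\subset G$ with center point $x$, and let $\partial^{\mathrm{vis}}_{x,c}G=\partial G\cap\partial G_{x,c}$ be the $c$-visual boundary of $G$ near $x$. Assume that there are $\lambda$ with $n-sp<\lambda\le n$ and constants $C_0>0$, $c\ge 1$ such that $$\mathcal{H}^\lambda_\infty\big(\partial^{\mathrm{vis}}_{x,c}G\big)\ge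 C_0\operatorname{dist}(x,\partial G)^\lambda\qquad\text{for all }x\in G.$$ Then $G$ admits an $(s,p)$-Hardy inequality: there is a constant $C>0$ such that $$\int_G\frac{|u(x)|^p}{\operatorname{dist}(x,\partial G)^{sp}}\,dx\le C\int_G\int_G\frac{|u(x)-u(y)|^p}{|x-y|^{n+sp}}\,dy\,dx$$ for every $u\in C_0^\infty(G)$, that is, for every smooth complex-valued function $u$ on $\mathbb{R}^n$ whose support is a compact subset of $G$. -/

import Mathlib

open scoped ENNReal ContDiff

noncomputable section

/-- The `lam`-Hausdorff content of `E ⊆ ℝⁿ`: the infimum of `∑ rᵢ ^ lam` over all countable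
coverings of `E` by open balls `B(xᵢ, rᵢ)` with `rᵢ > 0`. -/
def hausdorffContent {n : ℕ} (lam : ℝ) (E : Set (EuclideanSpace ℝ (Fin n))) : ℝ≥0∞ :=
  sInf {a : ℝ≥0∞ | ∃ (x : ℕ → EuclideanSpace ℝ (Fin n)) (r : ℕ → ℝ),
    (∀ i, 0 < r i) ∧ E ⊆ ⋃ i, Metric.ball (x i) (r i) ∧
    a = ∑' i, ENNReal.ofReal (r i ^ lam)}

/-- `U` is a `c`-John domain with center point `x₀`: `U` is open and connected, and every `x ∈ U`
can be joined to `x₀` by a curve `γ : [0, ℓ] → U`, parametrized by arc length, with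
`γ 0 = x`, `γ ℓ = x₀` and `dist (γ t, ∂U) ≥ t / c` for all `t ∈ [0, ℓ]`.
(Only proper subsets `U ≠ ℝⁿ` matter, for which `∂U` is nonempty.) -/
def IsJohnDomain {n : ℕ} (c : ℝ) (x₀ : EuclideanSpace ℝ (Fin n))
    (U : Set (EuclideanSpace ℝ (Fin n))) : Prop :=
  IsOpen U ∧ IsConnected U ∧
    ∀ x ∈ U, ∃ (ℓ : ℝ) (γ : ℝ → EuclideanSpace ℝ (Fin n)),
      0 ≤ ℓ ∧ HasUnitSpeedOn γ (Set.Icc 0 ℓ) ∧ Set.MapsTo γ (Set.Icc 0 ℓ) U ∧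
      γ 0 = x ∧ γ ℓ = x₀ ∧
      ∀ t ∈ Set.Icc 0 ℓ, t / c ≤ Metric.infDist (γ t) (frontier U)

/-- The subdomain `G_{x,c}`: the union of all `c`-John domains `U ⊆ G` with center point `x`. -/
def johnSubdomain {n : ℕ} (G : Set (EuclideanSpace ℝ (Fin n))) (x : EuclideanSpace ℝ (Fin n))
    (c : ℝ) : Set (EuclideanSpace ℝ (Fin n)) :=
  ⋃₀ {U | U ⊆ G ∧ IsJohnDomain c x U}

/-- The `c`-visual boundary of `G` near `x`: `∂G ∩ ∂G_{x,c}`. -/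
def visualBoundary {n : ℕ} (G : Set (EuclideanSpace ℝ (Fin n))) (x : EuclideanSpace ℝ (Fin n))
    (c : ℝ) : Set (EuclideanSpace ℝ (Fin n)) :=
  frontier G ∩ frontier (johnSubdomain G x c)

/-- `G` admits an `(s,p)`-Hardy inequality: there is a constant `c > 0` such that, for all
`u ∈ C₀^∞(G)` (smooth complex-valued functions with compact support in `G`),
`∫_G |u(x)|^p / dist(x,∂G)^{sp} dx ≤ c ∫_G ∫_G |u(x) - u(y)|^p / |x - y|^{n+sp} dy dx`.
The integrals are Lebesgue integrals of nonnegative functions, with values in `[0,∞]`. -/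
def AdmitsFractionalHardy {n : ℕ} (s p : ℝ) (G : Set (EuclideanSpace ℝ (Fin n))) : Prop :=
  ∃ c : ℝ, 0 < c ∧ ∀ u : EuclideanSpace ℝ (Fin n) → ℂ,
    ContDiff ℝ ∞ u → HasCompactSupport u → tsupport u ⊆ G →
    ∫⁻ x in G, ENNReal.ofReal (‖u x‖ ^ p / Metric.infDist x (frontier G) ^ (s * p)) ≤
      ENNReal.ofReal c *
        ∫⁻ x in G, ∫⁻ y in G, ENNReal.ofReal (‖u x - u y‖ ^ p / ‖x - y‖ ^ ((n : ℝ) + s * p))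

end

/-!
The argument chains averages of `u` along John curves and replaces a Whitney decomposition and
a maximal function by a weight with a small power of the distance to the boundary.

Write `d = dist (x, ∂G)`, `F y` for the inner integral of the fractional energy (`fracEnergy`), and
`lam = n - s p + 2 ε`, where `ε > 0` by assumption. Let `a₀` be the average of `u` over
`B(x, d / 4)`. The oscillation `|u x - a₀| ^ p` is at most a multiple of `d ^ (s p) * F x` by
Jensen's inequality, so `a₀` is what has to be estimated.

For a point `ξ` of the visual boundary near `x`, a John curve ending close to `ξ` provides points
`zᵢ`, starting at `z₀ = x`, such that the balls `Bᵢ = B(zᵢ, θ ^ i d / 4)` lie well inside `G`, are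
comparable to their successors, and are at distance at most a multiple of their radius from `ξ`
until they enter the region near `ξ` where `u` vanishes (`exists_chain_of_mem_visualBoundary`).
The averages over the `Bᵢ` go from `a₀` to `0`, so at least one increment exceeds a geometric
sequence with slow decay. With the fractional Poincaré inequality for neighbouring balls, some
ball `B(z, ρ / 4)` with `|z - ξ| ≲ ρ` satisfies
`|a₀| ^ p * ρ ^ lam * d ^ (-2 ε) ≲ ∫_{B(z, ρ / 4)} F y * (dist (y, ∂G) / d) ^ ε dy`
(`exists_ball_average_le_lintegral_fracEnergy`). A Vitali covering turns these bounds into one for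
the Hausdorff content of the visual boundary (`mul_hausdorffContent_le`), and the visibility
assumption gives
`|a₀| ^ p * d ^ (n - s p) ≲ ∫_{G ∩ B(x, (c + 1) d)} F y * (dist (y, ∂G) / d) ^ ε dy`.

On this domain `d` is bounded below by a multiple of `|x - y| + dist (y, ∂G)`, so after division by
`d ^ n` the weight is at most a multiple of
`dist (y, ∂G) ^ ε * (|x - y| + dist (y, ∂G)) ^ (-(n + ε))`. Its integral over `x` is bounded
uniformly in `y`, and Tonelli's theorem finishes the proof.
-/

/-! ### Distances to the boundary and chains of points in John domains -/

theorem infDist_frontier_le_dist {E : Type*} [NormedAddCommGroup E] [NormedSpace ℝ E]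
    [FiniteDimensional ℝ E] {U : Set E} {z w : E} (hz : z ∈ U) (hw : w ∉ U) :
    Metric.infDist z (frontier U) ≤ dist z w := by
  have hU : U ≠ Set.univ := fun h => hw (h ▸ Set.mem_univ w)
  obtain ⟨y, hy, hzy⟩ := exists_mem_frontier_infDist_compl_eq_dist hz hU
  calc Metric.infDist z (frontier U) ≤ dist z y := Metric.infDist_le_dist_of_mem hy
    _ = Metric.infDist z Uᶜ := hzy.symm
    _ ≤ dist z w := Metric.infDist_le_dist_of_mem hw

theorem frontier_nonempty_of_mem {E : Type*} [NormedAddCommGroup E] [NormedSpace ℝ E]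
    [FiniteDimensional ℝ E] {U : Set E} {z : E} (hz : z ∈ U) (hU : U ≠ Set.univ) :
    (frontier U).Nonempty := by
  obtain ⟨y, hy, -⟩ := exists_mem_frontier_infDist_compl_eq_dist hz hU
  exact ⟨y, hy⟩

theorem notMem_of_mem_frontier {X : Type*} [TopologicalSpace X] {U : Set X} (hU : IsOpen U)
    {w : X} (hw : w ∈ frontier U) : w ∉ U := by
  rw [hU.frontier_eq] at hw
  exact hw.2

theorem infDist_frontier_pos {E : Type*} [NormedAddCommGroup E] [NormedSpace ℝ E]
    [FiniteDimensional ℝ E] {U : Set E} {z : E} (hU : IsOpen U) (hz : z ∈ U)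
    (hne : U ≠ Set.univ) : 0 < Metric.infDist z (frontier U) :=
  (isClosed_frontier.notMem_iff_infDist_pos (frontier_nonempty_of_mem hz hne)).1
    fun h => notMem_of_mem_frontier hU h hz

theorem infDist_frontier_mono {E : Type*} [NormedAddCommGroup E] [NormedSpace ℝ E]
    [FiniteDimensional ℝ E] {U G : Set E} {z : E} (hG : IsOpen G) (hne : G ≠ Set.univ)
    (hUG : U ⊆ G) (hz : z ∈ U) :
    Metric.infDist z (frontier U) ≤ Metric.infDist z (frontier G) := by
  refine (Metric.le_infDist (frontier_nonempty_of_mem (hUG hz) hne)).2 fun w hw => ?_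
  exact infDist_frontier_le_dist hz fun h => notMem_of_mem_frontier hG hw (hUG h)

theorem ball_subset_of_le_infDist_frontier {E : Type*} [NormedAddCommGroup E] [NormedSpace ℝ E]
    [FiniteDimensional ℝ E] {G : Set E} {z : E} {r : ℝ} (hz : z ∈ G)
    (hr : r ≤ Metric.infDist z (frontier G)) : Metric.ball z r ⊆ G := by
  intro w hw
  by_contra hwG
  have := infDist_frontier_le_dist hz hwG
  rw [Metric.mem_ball, dist_comm] at hw
  linarith

theorem dist_le_of_hasUnitSpeedOn {E : Type*} [PseudoMetricSpace E] {γ : ℝ → E} {ℓ a b : ℝ}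
    (hγ : HasUnitSpeedOn γ (Set.Icc 0 ℓ)) (ha : 0 ≤ a) (hab : a ≤ b) (hb : b ≤ ℓ) :
    dist (γ a) (γ b) ≤ b - a := by
  have hA : a ∈ Set.Icc 0 ℓ := ⟨ha, hab.trans hb⟩
  have hB : b ∈ Set.Icc 0 ℓ := ⟨ha.trans hab, hb⟩
  have h1 := hγ hA hB
  have h2 := eVariationOn.edist_le γ (s := Set.Icc 0 ℓ ∩ Set.Icc a b)
    (x := a) (y := b) ⟨hA, le_rfl, hab⟩ ⟨hB, hab, le_rfl⟩
  rw [h1, edist_dist] at h2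
  have := (ENNReal.ofReal_le_ofReal_iff (by simpa using hab)).1 h2
  simpa using this

/-- A point `ξ` of the visual boundary is approached from `x` by a sequence of points of `G` whose
distances to `ξ` and to `∂G` are both controlled by the same geometric progression. The points are
taken on the John curve that joins `x` to a point within `η` of `ξ`; the arc length parameter,
measured from the latter point, decays geometrically. -/
theorem exists_chain_of_mem_visualBoundary {n : ℕ} {G : Set (EuclideanSpace ℝ (Fin n))}
    (hG : IsOpen G) (hne : G ≠ Set.univ) {x ξ : EuclideanSpace ℝ (Fin n)} {c θ η : ℝ}
    (hc : 1 ≤ c) (hθ0 : 0 < θ) (hθ1 : θ ≤ 1) (hη : 0 < η) (hξ : ξ ∈ visualBoundary G x c) :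
    ∃ z : ℕ → EuclideanSpace ℝ (Fin n), z 0 = x ∧ ∀ i, z i ∈ G ∧
      θ ^ i * Metric.infDist x (frontier G) ≤ Metric.infDist (z i) (frontier G) ∧
      dist (z i) (z (i + 1)) ≤ c * (1 - θ) * (θ ^ i * Metric.infDist x (frontier G)) ∧
      dist (z i) ξ ≤ η + c * (θ ^ i * Metric.infDist x (frontier G)) ∧
      dist (z i) x ≤ c * Metric.infDist x (frontier G) := by
  have hcl : ξ ∈ closure (johnSubdomain G x c) := frontier_subset_closure hξ.2
  obtain ⟨x', hx', hdist⟩ := Metric.mem_closure_iff.1 hcl η hη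
  obtain ⟨U, ⟨hUG, hUo, -, hU⟩, hxU⟩ := hx'
  obtain ⟨ℓ, γ, hℓ, hsp, hmaps, h0, h1, hd⟩ := hU x' hxU
  have hc0 : 0 < c := by linarith
  set d := Metric.infDist x (frontier G) with hdef
  have hd0 : 0 ≤ d := Metric.infDist_nonneg
  have hxmem : x ∈ U := h1 ▸ hmaps ⟨hℓ, le_rfl⟩
  have hℓd : ℓ ≤ c * d := by
    have h2 := hd ℓ ⟨hℓ, le_rfl⟩
    rw [h1, div_le_iff₀ hc0] at h2
    have h3 := infDist_frontier_mono hG hne hUG hxmem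
    nlinarith
  have ht : ∀ i : ℕ, min ℓ (c * (θ ^ i * d)) ∈ Set.Icc 0 ℓ := fun i =>
    ⟨le_min hℓ (by positivity), min_le_left _ _⟩
  refine ⟨fun i => γ (min ℓ (c * (θ ^ i * d))), ?_, fun i => ⟨hUG (hmaps (ht i)), ?_, ?_, ?_, ?_⟩⟩
  · simp [min_eq_left hℓd, h1]
  · rcases le_total ℓ (c * (θ ^ i * d)) with h | h
    · simp only [min_eq_left h, h1]
      exact mul_le_of_le_one_left hd0 (pow_le_one₀ hθ0.le hθ1)
    · have h2 := hd _ (ht i)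
      have h3 := infDist_frontier_mono hG hne hUG (hmaps (ht i))
      refine le_trans ?_ (h2.trans h3)
      rw [min_eq_right h, mul_div_cancel_left₀ _ hc0.ne']
  · have hle : θ ^ (i + 1) * d ≤ θ ^ i * d := by
      exact mul_le_mul_of_nonneg_right (pow_le_pow_of_le_one hθ0.le hθ1 (Nat.le_succ i)) hd0
    have hmin : min ℓ (c * (θ ^ (i + 1) * d)) ≤ min ℓ (c * (θ ^ i * d)) := by gcongr
    rw [dist_comm]
    refine (dist_le_of_hasUnitSpeedOn hsp (ht (i + 1)).1 hmin (ht i).2).trans ?_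
    have hpow : θ ^ (i + 1) = θ ^ i * θ := pow_succ _ _
    have hcle : c * (θ ^ (i + 1) * d) ≤ c * (θ ^ i * d) := by gcongr
    have heq : c * (1 - θ) * (θ ^ i * d) = c * (θ ^ i * d) - c * (θ ^ (i + 1) * d) := by
      rw [hpow]; ring
    rw [heq]
    rcases le_total ℓ (c * (θ ^ (i + 1) * d)) with h | h
    · rw [min_eq_left h]
      linarith [min_le_left ℓ (c * (θ ^ i * d))]
    · rw [min_eq_right h]
      linarith [min_le_right ℓ (c * (θ ^ i * d))]
  · have h2 := dist_le_of_hasUnitSpeedOn hsp le_rfl (ht i).1 (ht i).2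
    rw [h0, dist_comm] at h2
    have h3 := dist_triangle (γ (min ℓ (c * (θ ^ i * d)))) x' ξ
    rw [dist_comm x' ξ] at h3
    linarith [min_le_right ℓ (c * (θ ^ i * d))]
  · have h2 := dist_le_of_hasUnitSpeedOn hsp (ht i).1 (ht i).2 le_rfl
    rw [h1] at h2
    linarith [(ht i).1]

/-- If a sequence starting at `a 0` eventually reaches `0`, then not all of its increments can lie
strictly below a geometric progression with sum `‖a 0‖`. -/
theorem exists_geometric_le_norm_sub {F : Type*} [NormedAddCommGroup F] {a : ℕ → F} {q : ℝ}
    (hq0 : 0 < q) (ha0 : a 0 ≠ 0) {N : ℕ} (hN : a N = 0) :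
    ∃ i, (1 - q) * q ^ i * ‖a 0‖ ≤ ‖a i - a (i + 1)‖ := by
  by_contra! h
  have hpos : 0 < ‖a 0‖ := norm_pos_iff.2 ha0
  have hk : ∀ k, ‖a 0 - a k‖ ≤ (1 - q ^ k) * ‖a 0‖ := by
    intro k
    induction k with
    | zero => simp
    | succ k ih =>
      have h1 : ‖a 0 - a (k + 1)‖ ≤ ‖a 0 - a k‖ + ‖a k - a (k + 1)‖ := by
        have := norm_add_le (a 0 - a k) (a k - a (k + 1))
        rwa [sub_add_sub_cancel] at this
      have h2 := h k
      have h3 : (1 - q ^ (k + 1)) * ‖a 0‖ =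
        (1 - q ^ k) * ‖a 0‖ + (1 - q) * q ^ k * ‖a 0‖ := by ring
      linarith
  have := hk N
  rw [hN, sub_zero] at this
  nlinarith [mul_pos (pow_pos hq0 N) hpos]

/-! ### Hausdorff content and the Vitali covering lemma -/

/-- A countable family of balls, possibly finite, bounds the Hausdorff content: it is completed to
a sequence by balls whose radii contribute arbitrarily little. -/
theorem hausdorffContent_le_tsum {n : ℕ} {lam : ℝ} (hlam : 0 < lam) {ι : Type*} [Countable ι]
    {A : Set (EuclideanSpace ℝ (Fin n))} {x : ι → EuclideanSpace ℝ (Fin n)} {r : ι → ℝ}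
    (hr : ∀ i, 0 < r i) (hA : A ⊆ ⋃ i, Metric.ball (x i) (r i)) :
    hausdorffContent lam A ≤ ∑' i, ENNReal.ofReal (r i ^ lam) := by
  refine ENNReal.le_of_forall_pos_le_add fun ε hε _ => ?_
  obtain ⟨δ, hδ0, hδ⟩ := ENNReal.exists_pos_sum_of_countable (ENNReal.coe_pos.2 hε).ne' ℕ
  obtain ⟨f, hf⟩ := exists_injective_nat ι
  classical
  let X : ℕ → EuclideanSpace ℝ (Fin n) := fun k => if h : ∃ i, f i = k then x h.choose else 0
  let R : ℕ → ℝ := fun k => if h : ∃ i, f i = k then r h.choose else (δ k : ℝ) ^ (lam⁻¹)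
  have hch : ∀ i, (⟨i, rfl⟩ : ∃ j, f j = f i).choose = i := fun i =>
    hf (⟨i, rfl⟩ : ∃ j, f j = f i).choose_spec
  have hXf : ∀ i, X (f i) = x i := fun i => by
    simp only [X]
    rw [dif_pos ⟨i, rfl⟩, hch]
  have hRf : ∀ i, R (f i) = r i := fun i => by
    simp only [R]
    rw [dif_pos ⟨i, rfl⟩, hch]
  have hRn : ∀ k, (¬ ∃ i, f i = k) → ENNReal.ofReal (R k ^ lam) = δ k := fun k hk => by
    simp only [R]
    rw [dif_neg hk, Real.rpow_inv_rpow (δ k).coe_nonneg hlam.ne', ENNReal.ofReal_coe_nnreal]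
  have hmem : (∑' k, ENNReal.ofReal (R k ^ lam)) ∈ {a : ℝ≥0∞ |
      ∃ (x : ℕ → EuclideanSpace ℝ (Fin n)) (r : ℕ → ℝ), (∀ i, 0 < r i) ∧
      A ⊆ ⋃ i, Metric.ball (x i) (r i) ∧ a = ∑' i, ENNReal.ofReal (r i ^ lam)} := by
    refine ⟨X, R, fun k => ?_, fun y hy => ?_, rfl⟩
    · simp only [R]
      split_ifs with h
      · exact hr _
      · exact Real.rpow_pos_of_pos (hδ0 k) _
    · obtain ⟨i, hi⟩ := Set.mem_iUnion.1 (hA hy)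
      refine Set.mem_iUnion.2 ⟨f i, ?_⟩
      rwa [hXf, hRf]
  refine (sInf_le hmem).trans ?_
  have hle : ∀ k, ENNReal.ofReal (R k ^ lam) ≤
      Set.indicator (Set.range f) (fun k => ENNReal.ofReal (R k ^ lam)) k + δ k := by
    intro k
    by_cases hk : k ∈ Set.range f
    · rw [Set.indicator_of_mem hk]
      exact le_self_add
    · rw [Set.indicator_of_notMem hk, zero_add, hRn k hk]
  refine (ENNReal.tsum_le_tsum hle).trans ?_
  rw [ENNReal.tsum_add]
  refine add_le_add (le_of_eq ?_) hδ.le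
  rw [← tsum_subtype (Set.range f), tsum_range (fun k => ENNReal.ofReal (R k ^ lam)) hf]
  simp only [hRf]

/-- A content bound obtained from the Vitali covering lemma. Each `ξ ∈ A` has a ball of radius
`ρ / 4` centered within `K * ρ` of `ξ`, whose `μ`-measure is at least `a * ρ ^ lam`. The dilated
balls are used for covering `A`, the small ones for disjointness. -/
theorem mul_hausdorffContent_le {n : ℕ} {lam K ρmax : ℝ} (hlam : 0 < lam) (hK : 1 ≤ K)
    {A S : Set (EuclideanSpace ℝ (Fin n))} {a : ℝ≥0∞}
    (μ : MeasureTheory.Measure (EuclideanSpace ℝ (Fin n)))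
    (h : ∀ ξ ∈ A, ∃ (z : EuclideanSpace ℝ (Fin n)) (ρ : ℝ), 0 < ρ ∧ ρ ≤ ρmax ∧
      dist z ξ ≤ K * ρ ∧ Metric.ball z (ρ / 4) ⊆ S ∧
      a * ENNReal.ofReal (ρ ^ lam) ≤ μ (Metric.ball z (ρ / 4))) :
    a * hausdorffContent lam A ≤ ENNReal.ofReal ((6 * K) ^ lam) * μ S := by
  choose! z ρ hρ0 hρmax hdist hsub hle using h
  obtain ⟨v, hvA, hdisj, hcov⟩ := Vitali.exists_disjoint_subfamily_covering_enlargement_closedBall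
    A z (fun ξ => K * ρ ξ) (K * ρmax) (fun ξ hξ => by have := hρmax ξ hξ; gcongr) 5 (by norm_num)
  have hdisj' : v.PairwiseDisjoint fun ξ => Metric.ball (z ξ) (ρ ξ / 4) := by
    refine hdisj.mono_on fun ξ hξ => Metric.ball_subset_closedBall.trans
      (Metric.closedBall_subset_closedBall ?_)
    have := hρ0 ξ (hvA hξ)
    nlinarith
  have hcount : v.Countable := hdisj'.countable_of_isOpen (fun _ _ => Metric.isOpen_ball)
    fun ξ hξ => ⟨z ξ, Metric.mem_ball_self (by have := hρ0 ξ (hvA hξ); positivity)⟩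
  have : Countable v := hcount
  have hcontent : hausdorffContent lam A ≤
      ∑' ξ : v, ENNReal.ofReal ((6 * K * ρ ξ) ^ lam) := by
    refine hausdorffContent_le_tsum (x := fun ξ : v => z ξ) hlam
      (fun ξ => by have := hρ0 ξ (hvA ξ.2); positivity) fun ξ hξ => ?_
    obtain ⟨b, hb, hsubset⟩ := hcov ξ hξ
    refine Set.mem_iUnion.2 ⟨⟨b, hb⟩, ?_⟩
    have h1 : ξ ∈ Metric.closedBall (z ξ) (K * ρ ξ) := by
      rw [Metric.mem_closedBall, dist_comm]
      exact hdist ξ hξ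
    have h2 := Metric.mem_closedBall.1 (hsubset h1)
    have := hρ0 b (hvA hb)
    rw [Metric.mem_ball]
    have : 0 < K * ρ b := by positivity
    change dist ξ (z b) < 6 * K * ρ b
    linarith
  have hK0 : 0 ≤ 6 * K := by linarith
  calc a * hausdorffContent lam A
      ≤ a * ∑' ξ : v, ENNReal.ofReal ((6 * K * ρ ξ) ^ lam) := by gcongr
    _ = ∑' ξ : v, ENNReal.ofReal ((6 * K) ^ lam) * (a * ENNReal.ofReal (ρ ξ ^ lam)) := by
        rw [← ENNReal.tsum_mul_left]
        refine tsum_congr fun ξ => ?_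
        rw [Real.mul_rpow hK0 (hρ0 ξ (hvA ξ.2)).le, ENNReal.ofReal_mul (by positivity)]
        ring
    _ ≤ ∑' ξ : v, ENNReal.ofReal ((6 * K) ^ lam) * μ (Metric.ball (z ξ) (ρ ξ / 4)) := by
        refine ENNReal.tsum_le_tsum fun ξ => ?_
        gcongr
        exact hle ξ (hvA ξ.2)
    _ = ENNReal.ofReal ((6 * K) ^ lam) * μ (⋃ ξ ∈ v, Metric.ball (z ξ) (ρ ξ / 4)) := by
        rw [ENNReal.tsum_mul_left,
          MeasureTheory.measure_biUnion hcount hdisj' fun _ _ => Metric.isOpen_ball.measurableSet]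
    _ ≤ ENNReal.ofReal ((6 * K) ^ lam) * μ S := by
        gcongr
        exact Set.iUnion₂_subset fun ξ hξ => hsub ξ (hvA hξ)

/-! ### Averages over balls and the fractional Poincaré inequality -/

/-- The inner integral over `G` of the fractional Sobolev energy, as a function of the outer
variable `y`. -/
noncomputable def fracEnergy {n : ℕ} (s p : ℝ) (G : Set (EuclideanSpace ℝ (Fin n)))
    (u : EuclideanSpace ℝ (Fin n) → ℂ) (y : EuclideanSpace ℝ (Fin n)) : ℝ≥0∞ :=
  ∫⁻ z in G, ENNReal.ofReal (‖u y - u z‖ ^ p / ‖y - z‖ ^ ((n : ℝ) + s * p))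

section Averages

open MeasureTheory

variable {n : ℕ} {s p : ℝ} {G : Set (EuclideanSpace ℝ (Fin n))}
  {u : EuclideanSpace ℝ (Fin n) → ℂ}

theorem measurable_fracEnergy (hu : Continuous u) : Measurable (fracEnergy s p G u) := by
  have hm : Measurable (Function.uncurry fun y z : EuclideanSpace ℝ (Fin n) =>
      ENNReal.ofReal (‖u y - u z‖ ^ p / ‖y - z‖ ^ ((n : ℝ) + s * p))) := by
    have h1 : Measurable u := hu.measurable
    unfold Function.uncurry
    fun_prop
  exact hm.lintegral_prod_right'

theorem setLIntegral_rpow_norm_sub_le_fracEnergy (hs : 0 ≤ s) (hp : 0 < p)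
    {B : Set (EuclideanSpace ℝ (Fin n))} (hB : MeasurableSet B) (hBG : B ⊆ G)
    {y : EuclideanSpace ℝ (Fin n)} {ρ : ℝ} (hρ : ∀ w ∈ B, dist y w ≤ ρ) :
    ∫⁻ w in B, ENNReal.ofReal (‖u y - u w‖ ^ p) ≤
      ENNReal.ofReal (ρ ^ ((n : ℝ) + s * p)) * fracEnergy s p G u y := by
  have hm : 0 ≤ (n : ℝ) + s * p := by positivity
  rw [fracEnergy, ← lintegral_const_mul' _ _ ENNReal.ofReal_ne_top]
  refine le_trans ?_ (lintegral_mono_set hBG)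
  refine setLIntegral_mono' hB fun w hw => ?_
  have hyw : ‖y - w‖ ≤ ρ := by rw [← dist_eq_norm]; exact hρ w hw
  rw [← ENNReal.ofReal_mul (Real.rpow_nonneg ((norm_nonneg _).trans hyw) _)]
  refine ENNReal.ofReal_le_ofReal ?_
  rcases eq_or_ne y w with rfl | hne
  · simp [Real.zero_rpow hp.ne']
  · have hpos : 0 < ‖y - w‖ ^ ((n : ℝ) + s * p) :=
      Real.rpow_pos_of_pos (norm_pos_iff.2 (sub_ne_zero.2 hne)) _
    rw [mul_div_left_comm]
    refine le_mul_of_one_le_right (by positivity) ((one_le_div hpos).2 ?_)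
    exact Real.rpow_le_rpow (norm_nonneg _) hyw hm

/-- Jensen's inequality for the convex function `v ↦ ‖v - w‖ ^ p`. -/
theorem rpow_norm_average_sub_mul_le (hu : Continuous u) (hp : 1 ≤ p)
    (z : EuclideanSpace ℝ (Fin n)) {r : ℝ} (hr : 0 < r) (w : ℂ) :
    ENNReal.ofReal (‖(⨍ y in Metric.ball z r, u y) - w‖ ^ p) * volume (Metric.ball z r) ≤
      ∫⁻ y in Metric.ball z r, ENNReal.ofReal (‖u y - w‖ ^ p) := by
  have hp0 : 0 ≤ p := by linarith
  have hconv : ConvexOn ℝ Set.univ fun v : ℂ => ‖v - w‖ ^ p := by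
    have h1 : ConvexOn ℝ Set.univ fun v : ℂ => ‖v - w‖ := by
      simpa only [dist_eq_norm] using convexOn_univ_dist w
    refine ⟨convex_univ, fun a _ b _ α β hα hβ hαβ => ?_⟩
    refine (Real.rpow_le_rpow (norm_nonneg _)
      (h1.2 (Set.mem_univ a) (Set.mem_univ b) hα hβ hαβ) hp0).trans ?_
    exact (convexOn_rpow hp).2 (norm_nonneg _) (norm_nonneg _) hα hβ hαβ
  have hcont : Continuous fun v : ℂ => ‖v - w‖ ^ p :=
    (continuous_id.sub continuous_const).norm.rpow_const fun _ => Or.inr hp0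
  have hint : ∀ {F : Type} [NormedAddCommGroup F] {f : EuclideanSpace ℝ (Fin n) → F},
      Continuous f → IntegrableOn f (Metric.ball z r) := fun {F} _ {f} hf =>
    (hf.continuousOn.integrableOn_compact (isCompact_closedBall z r)).mono_set
      Metric.ball_subset_closedBall
  have h0 : volume (Metric.ball z r) ≠ 0 := (Metric.measure_ball_pos volume z hr).ne'
  have htop : volume (Metric.ball z r) ≠ ⊤ := measure_ball_lt_top.ne
  have hJ := hconv.map_set_average_le (μ := volume) (t := Metric.ball z r) (f := u)
    hcont.continuousOn isClosed_univ h0 htop (by simp) (hint hu) (hint (hcont.comp hu))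
  rw [setAverage_eq volume (fun y => ‖u y - w‖ ^ p), smul_eq_mul] at hJ
  have hvpos : 0 < volume.real (Metric.ball z r) := ENNReal.toReal_pos h0 htop
  have hcu : Continuous fun y => ‖u y - w‖ ^ p := hcont.comp hu
  rw [← ofReal_integral_eq_lintegral_ofReal (hint hcu)
    (Filter.Eventually.of_forall fun y => by positivity), ← ENNReal.ofReal_toReal htop,
    ← ENNReal.ofReal_mul (by positivity)]
  refine ENNReal.ofReal_le_ofReal ?_
  change _ * volume.real (Metric.ball z r) ≤ _
  rw [inv_mul_eq_div, le_div_iff₀ hvpos] at hJ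
  exact hJ

/-- A fractional Poincaré inequality for the averages over two nearby balls. -/
theorem rpow_norm_average_sub_average_mul_le (hu : Continuous u) (hs : 0 ≤ s) (hp : 1 ≤ p)
    {z z' : EuclideanSpace ℝ (Fin n)} {r r' ρ : ℝ} (hr : 0 < r) (hr' : 0 < r')
    (hρ : dist z z' + r + r' ≤ ρ) (hG : Metric.ball z' r' ⊆ G) :
    ENNReal.ofReal (‖(⨍ y in Metric.ball z r, u y) - ⨍ y in Metric.ball z' r', u y‖ ^ p) *
      volume (Metric.ball z r) * volume (Metric.ball z' r') ≤
      ENNReal.ofReal (ρ ^ ((n : ℝ) + s * p)) * ∫⁻ y in Metric.ball z r, fracEnergy s p G u y := by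
  have htop' : volume (Metric.ball z' r') ≠ ⊤ := measure_ball_lt_top.ne
  refine (mul_le_mul_left (rpow_norm_average_sub_mul_le hu hp z hr _) _).trans ?_
  rw [← lintegral_mul_const' _ _ htop', ← lintegral_const_mul' _ _ ENNReal.ofReal_ne_top]
  refine setLIntegral_mono' measurableSet_ball fun y hy => ?_
  rw [norm_sub_rev]
  refine (rpow_norm_average_sub_mul_le hu hp z' hr' (u y)).trans ?_
  simp_rw [norm_sub_rev _ (u y)]
  refine setLIntegral_rpow_norm_sub_le_fracEnergy hs (by linarith) measurableSet_ball hG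
    fun w hw => ?_
  rw [Metric.mem_ball] at hy hw
  have h1 := dist_triangle4 y z z' w
  rw [dist_comm z' w] at h1
  linarith

theorem volume_ball_eq_ofReal_pow_mul (z : EuclideanSpace ℝ (Fin n)) {r : ℝ} (hr : 0 < r) :
    volume (Metric.ball z r) =
      ENNReal.ofReal (r ^ n * volume.real (Metric.ball (0 : EuclideanSpace ℝ (Fin n)) 1)) := by
  rw [Measure.addHaar_ball_of_pos volume z hr, finrank_euclideanSpace_fin,
    ENNReal.ofReal_mul (by positivity), Measure.real, ENNReal.ofReal_toReal measure_ball_lt_top.ne]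

/-- Integrating the kernel `(|x - y| + t) ^ (-(n + ε))` in `x` gives at most a constant multiple of
`t ^ (-ε)`, by scaling to `t = 1`. -/
theorem exists_lintegral_dist_add_rpow_le (n : ℕ) {ε : ℝ} (hε : 0 < ε) :
    ∃ C : ℝ, 0 < C ∧ ∀ (y : EuclideanSpace ℝ (Fin n)) (t : ℝ), 0 < t →
      ∫⁻ x, ENNReal.ofReal ((dist x y + t) ^ (-((n : ℝ) + ε))) ≤
        ENNReal.ofReal (C * t ^ (-ε)) := by
  have hfin : ∫⁻ x : EuclideanSpace ℝ (Fin n),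
      ENNReal.ofReal ((1 + ‖x‖) ^ (-((n : ℝ) + ε))) < ⊤ :=
    finite_integral_one_add_norm (by rw [finrank_euclideanSpace_fin]; linarith)
  set I := ∫⁻ x : EuclideanSpace ℝ (Fin n), ENNReal.ofReal ((1 + ‖x‖) ^ (-((n : ℝ) + ε))) with hI
  refine ⟨I.toReal + 1, by positivity, fun y t ht => ?_⟩
  have hshift : ∫⁻ x, ENNReal.ofReal ((dist x y + t) ^ (-((n : ℝ) + ε))) =
      ∫⁻ x : EuclideanSpace ℝ (Fin n), ENNReal.ofReal ((‖x‖ + t) ^ (-((n : ℝ) + ε))) := by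
    simp_rw [dist_eq_norm]
    exact lintegral_sub_right_eq_self
      (fun x : EuclideanSpace ℝ (Fin n) => ENNReal.ofReal ((‖x‖ + t) ^ (-((n : ℝ) + ε)))) y
  have hmeas : Measurable fun x : EuclideanSpace ℝ (Fin n) =>
      ENNReal.ofReal ((‖x‖ + t) ^ (-((n : ℝ) + ε))) := by fun_prop
  have hscale : ENNReal.ofReal ((t ^ n)⁻¹) * ∫⁻ x : EuclideanSpace ℝ (Fin n),
      ENNReal.ofReal ((‖x‖ + t) ^ (-((n : ℝ) + ε))) = ENNReal.ofReal (t ^ (-((n : ℝ) + ε))) * I := by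
    have h1 := lintegral_map (μ := volume) hmeas (measurable_const_smul t)
    rw [Measure.map_addHaar_smul volume ht.ne', lintegral_smul_measure,
      finrank_euclideanSpace_fin, abs_of_pos (by positivity), smul_eq_mul] at h1
    rw [h1, hI, ← lintegral_const_mul' _ _ ENNReal.ofReal_ne_top]
    refine lintegral_congr fun x => ?_
    rw [norm_smul, Real.norm_of_nonneg ht.le, ← ENNReal.ofReal_mul (by positivity),
      ← Real.mul_rpow ht.le (by positivity)]
    congr 2
    ring
  have hpow : t ^ n * t ^ (-((n : ℝ) + ε)) = t ^ (-ε) := by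
    rw [← Real.rpow_natCast, ← Real.rpow_add ht]
    congr 1
    ring
  rw [hshift]
  calc ∫⁻ x : EuclideanSpace ℝ (Fin n), ENNReal.ofReal ((‖x‖ + t) ^ (-((n : ℝ) + ε)))
      = ENNReal.ofReal (t ^ n) * (ENNReal.ofReal ((t ^ n)⁻¹) *
        ∫⁻ x : EuclideanSpace ℝ (Fin n), ENNReal.ofReal ((‖x‖ + t) ^ (-((n : ℝ) + ε)))) := by
        rw [← mul_assoc, ← ENNReal.ofReal_mul (by positivity),
          mul_inv_cancel₀ (by positivity), ENNReal.ofReal_one, one_mul]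
    _ = ENNReal.ofReal (t ^ (-ε)) * I := by
        rw [hscale, ← mul_assoc, ← ENNReal.ofReal_mul (by positivity), hpow]
    _ ≤ ENNReal.ofReal ((I.toReal + 1) * t ^ (-ε)) := by
        rw [mul_comm, ENNReal.ofReal_mul (by positivity)]
        gcongr
        rw [← ENNReal.ofReal_toReal hfin.ne]
        exact ENNReal.ofReal_le_ofReal (by rw [ENNReal.ofReal_toReal hfin.ne]; linarith)

end Averages

/-! ### Chains of averages -/

section Chaining

open MeasureTheory

/-- For each point `ξ` of the visual boundary near `x`, one of the balls of the chain from `x` to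
`ξ` carries enough fractional energy to control the average of `u` near `x`. The weight
`(dist (y, ∂G) / dist (x, ∂G)) ^ ε` is the gain that makes the resulting estimates
summable over `x`. -/
theorem exists_ball_average_le_lintegral_fracEnergy (n : ℕ) {s p c ε : ℝ} (hs : 0 ≤ s)
    (hp : 1 ≤ p) (hc : 1 ≤ c) (hε : 0 < ε) :
    ∃ C : ℝ, 0 < C ∧ ∀ (G : Set (EuclideanSpace ℝ (Fin n))) (u : EuclideanSpace ℝ (Fin n) → ℂ),
      IsOpen G → G ≠ Set.univ → Continuous u → tsupport u ⊆ G → ∀ x ∈ G,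
      (⨍ y in Metric.ball x (Metric.infDist x (frontier G) / 4), u y) ≠ 0 →
      ∀ ξ ∈ visualBoundary G x c, ∃ (z : EuclideanSpace ℝ (Fin n)) (ρ : ℝ), 0 < ρ ∧
        ρ ≤ Metric.infDist x (frontier G) ∧ dist z ξ ≤ 3 * c * ρ ∧
        dist z x ≤ c * Metric.infDist x (frontier G) ∧ z ∈ G ∧
        ρ ≤ Metric.infDist z (frontier G) ∧
        ENNReal.ofReal (‖⨍ y in Metric.ball x (Metric.infDist x (frontier G) / 4), u y‖ ^ p *
          (ρ / Metric.infDist x (frontier G)) ^ (2 * ε) * ρ ^ ((n : ℝ) - s * p)) ≤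
        ENNReal.ofReal C * ∫⁻ y in Metric.ball z (ρ / 4), fracEnergy s p G u y *
          ENNReal.ofReal ((Metric.infDist y (frontier G) / Metric.infDist x (frontier G)) ^ ε) := by
  have hp0 : 0 < p := by linarith
  have hc0 : 0 < c := by linarith
  -- With this ratio the radii decay slowly enough for consecutive balls to be comparable.
  set θ : ℝ := 1 - 1 / (4 * c) with hθ
  have h4c : 1 / (4 * c) ≤ 1 / 4 := by
    rw [div_le_div_iff₀ (by positivity) (by norm_num)]; linarith
  have h4c0 : 0 < 1 / (4 * c) := by positivity
  have hθ0 : 0 < θ := by linarith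
  have hθ1 : θ < 1 := by linarith
  have hcθ : c * (1 - θ) = 1 / 4 := by rw [hθ]; field_simp; ring
  set q : ℝ := θ ^ (ε / p) with hq
  have hq0 : 0 < q := Real.rpow_pos_of_pos hθ0 _
  have hq1 : q < 1 := Real.rpow_lt_one hθ0.le hθ1 (by positivity)
  set V := volume.real (Metric.ball (0 : EuclideanSpace ℝ (Fin n)) 1) with hV
  have hV0 : 0 < V := ENNReal.toReal_pos (Metric.measure_ball_pos volume _ one_pos).ne'
    measure_ball_lt_top.ne
  set K : ℝ := (1 - q) ^ p * ((θ / 16) ^ n * V ^ 2) * (3 / 4 : ℝ) ^ ε with hK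
  have h1q : 0 < 1 - q := by linarith
  have hK0 : 0 < K := by positivity
  refine ⟨K⁻¹, inv_pos.2 hK0, fun G u hG hne hu hsupp x hx ha0 ξ hξ => ?_⟩
  set d := Metric.infDist x (frontier G) with hd
  have hd0 : 0 < d := infDist_frontier_pos hG hx hne
  -- `u` vanishes near the boundary point `ξ`.
  have hξG : ξ ∉ G := notMem_of_mem_frontier hG hξ.1
  obtain ⟨η, hη0, hη⟩ := Metric.isOpen_iff.1 (isClosed_tsupport u).isOpen_compl ξ
    fun h => hξG (hsupp h)
  have hu0 : ∀ y, dist y ξ < η → u y = 0 := fun y hy =>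
    image_eq_zero_of_notMem_tsupport (hη hy)
  obtain ⟨z, hz0, hz⟩ := exists_chain_of_mem_visualBoundary hG hne hc hθ0 hθ1.le (half_pos hη0) hξ
  rw [← hd] at hz
  set a : ℕ → ℂ := fun i => ⨍ y in Metric.ball (z i) (θ ^ i * d / 4), u y with ha
  have ha00 : a 0 = ⨍ y in Metric.ball x (d / 4), u y := by simp [ha, hz0]
  have hzero : ∀ i, 2 * c * (θ ^ i * d) ≤ η / 2 → a i = 0 := by
    intro i hi
    have hρ : 0 < θ ^ i * d := by positivity
    simp only [ha]
    rw [setAverage_eq, setIntegral_eq_zero_of_forall_eq_zero, smul_zero]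
    intro y hy
    refine hu0 y ?_
    rw [Metric.mem_ball] at hy
    have h1 := dist_triangle y (z i) ξ
    have h2 := (hz i).2.2.2.1
    nlinarith
  obtain ⟨N, hN⟩ := exists_pow_lt_of_lt_one (show 0 < η / (4 * c * d) by positivity) hθ1
  have haN : a N = 0 := by
    refine hzero N ?_
    rw [lt_div_iff₀ (by positivity)] at hN
    linarith
  obtain ⟨i, hi⟩ := exists_geometric_le_norm_sub hq0 (by rw [ha00]; exact ha0) haN
  obtain ⟨hzG, hzd, hzz, hzξ, hzx⟩ := hz i
  have hpow : θ ^ (i + 1) * d = θ * (θ ^ i * d) := by rw [pow_succ]; ring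
  set ρ := θ ^ i * d with hρ
  have hρ0 : 0 < ρ := by positivity
  have hρd : ρ ≤ d := mul_le_of_le_one_left hd0.le (pow_le_one₀ hθ0.le hθ1.le)
  -- The increment is nonzero, so the chain has not yet entered the region where `u` vanishes.
  have hρη : η / 2 < 2 * c * ρ := by
    by_contra! hcon
    have h1 : a i = 0 := hzero i hcon
    have h2 : a (i + 1) = 0 := by
      refine hzero (i + 1) (le_trans ?_ hcon)
      rw [hpow]
      have : θ * ρ ≤ ρ := mul_le_of_le_one_left hρ0.le hθ1.le
      gcongr
    rw [h1, h2, sub_zero, norm_zero] at hi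
    have h3 : 0 < ‖a 0‖ := norm_pos_iff.2 (by rw [ha00]; exact ha0)
    have : 0 < (1 - q) * q ^ i * ‖a 0‖ := by positivity
    linarith
  refine ⟨z i, ρ, hρ0, hρd, by linarith, hzx, hzG, hzd, ?_⟩
  rw [hcθ] at hzz
  have hball : Metric.ball (z (i + 1)) (θ * ρ / 4) ⊆ G := by
    refine ball_subset_of_le_infDist_frontier (hz (i + 1)).1 (le_trans ?_ (hz (i + 1)).2.1)
    rw [hpow]
    have : 0 < θ * ρ := by positivity
    linarith
  have hθρ : θ * ρ ≤ ρ := mul_le_of_le_one_left hρ0.le hθ1.le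
  have hP := rpow_norm_average_sub_average_mul_le (s := s) (p := p) (ρ := ρ) (z := z i)
    (r := ρ / 4) hu hs hp (by positivity) (show 0 < θ * ρ / 4 by positivity) (by linarith) hball
  rw [volume_ball_eq_ofReal_pow_mul _ (by positivity),
    volume_ball_eq_ofReal_pow_mul _ (show 0 < θ * ρ / 4 by positivity), ← hV,
    ← ENNReal.ofReal_mul (by positivity), ← ENNReal.ofReal_mul (by positivity)] at hP
  set J := ∫⁻ y in Metric.ball (z i) (ρ / 4), fracEnergy s p G u y with hJ
  set b := ‖⨍ y in Metric.ball x (d / 4), u y‖ with hb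
  have hqi : (q ^ i) ^ p = (ρ / d) ^ ε := by
    rw [hρ, mul_div_cancel_right₀ _ hd0.ne', hq, ← Real.rpow_natCast, ← Real.rpow_natCast,
      ← Real.rpow_mul hθ0.le, ← Real.rpow_mul hθ0.le, ← Real.rpow_mul hθ0.le]
    congr 1
    field_simp
  have hjump : (1 - q) ^ p * (ρ / d) ^ ε * b ^ p ≤ ‖a i - a (i + 1)‖ ^ p := by
    rw [ha00] at hi
    have := Real.rpow_le_rpow (by positivity) hi hp0.le
    rwa [Real.mul_rpow (by positivity) (by positivity), Real.mul_rpow h1q.le (by positivity),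
      hqi] at this
  have hexp : (ρ / 4) ^ n * (θ * ρ / 4) ^ n =
      (θ / 16) ^ n * (ρ ^ ((n : ℝ) - s * p) * ρ ^ ((n : ℝ) + s * p)) := by
    rw [← Real.rpow_add hρ0, show (n : ℝ) - s * p + (n + s * p) = ((2 * n : ℕ) : ℝ) by
      push_cast; ring, Real.rpow_natCast, pow_mul, ← mul_pow, ← mul_pow]
    congr 1
    ring
  have hai : ‖a i - a (i + 1)‖ =
      ‖(⨍ y in Metric.ball (z i) (ρ / 4), u y) - ⨍ y in Metric.ball (z (i + 1)) (θ * ρ / 4), u y‖ := by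
    simp only [ha, ← hρ, hpow]
  rw [← hai] at hP
  have hm0 : 0 < ρ ^ ((n : ℝ) + s * p) := Real.rpow_pos_of_pos hρ0 _
  have hmain : ENNReal.ofReal ((1 - q) ^ p * ((θ / 16) ^ n * V ^ 2) *
      (b ^ p * (ρ / d) ^ ε * ρ ^ ((n : ℝ) - s * p))) ≤ J := by
    rw [← ENNReal.mul_le_mul_iff_right (ENNReal.ofReal_pos.2 hm0).ne' ENNReal.ofReal_ne_top]
    refine le_trans ?_ hP
    rw [← ENNReal.ofReal_mul hm0.le]
    refine ENNReal.ofReal_le_ofReal ?_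
    calc ρ ^ ((n : ℝ) + s * p) * ((1 - q) ^ p * ((θ / 16) ^ n * V ^ 2) *
          (b ^ p * (ρ / d) ^ ε * ρ ^ ((n : ℝ) - s * p)))
        = (1 - q) ^ p * (ρ / d) ^ ε * b ^ p *
          ((θ / 16) ^ n * (ρ ^ ((n : ℝ) - s * p) * ρ ^ ((n : ℝ) + s * p))) * V ^ 2 := by ring
      _ = (1 - q) ^ p * (ρ / d) ^ ε * b ^ p * ((ρ / 4) ^ n * (θ * ρ / 4) ^ n) * V ^ 2 := by
        rw [hexp]
      _ ≤ ‖a i - a (i + 1)‖ ^ p * ((ρ / 4) ^ n * (θ * ρ / 4) ^ n) * V ^ 2 := by gcongr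
      _ = ‖a i - a (i + 1)‖ ^ p * ((ρ / 4) ^ n * V) * ((θ * ρ / 4) ^ n * V) := by ring
  have hweight : ENNReal.ofReal ((3 / 4 : ℝ) ^ ε * (ρ / d) ^ ε) * J ≤
      ∫⁻ y in Metric.ball (z i) (ρ / 4), fracEnergy s p G u y *
        ENNReal.ofReal ((Metric.infDist y (frontier G) / d) ^ ε) := by
    rw [hJ, ← lintegral_const_mul' _ _ ENNReal.ofReal_ne_top]
    refine setLIntegral_mono' measurableSet_ball fun y hy => ?_
    rw [mul_comm]
    gcongr
    rw [← Real.mul_rpow (by norm_num) (by positivity), ← mul_div_assoc]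
    have h1 := Metric.infDist_le_infDist_add_dist (s := frontier G) (x := z i) (y := y)
    rw [Metric.mem_ball, dist_comm] at hy
    have : 3 / 4 * ρ ≤ Metric.infDist y (frontier G) := by linarith
    gcongr
  have hsplit : (ρ / d) ^ (2 * ε) = (ρ / d) ^ ε * (ρ / d) ^ ε := by
    rw [two_mul, Real.rpow_add (by positivity)]
  refine le_trans (le_of_eq ?_) (mul_le_mul_right ((mul_le_mul_right hmain _).trans hweight) _)
  rw [← ENNReal.ofReal_mul (by positivity), ← ENNReal.ofReal_mul (by positivity)]
  congr 1
  rw [hsplit, eq_inv_mul_iff_mul_eq₀ hK0.ne', hK]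
  ring

/-- Under the visibility condition, the average of `u` near `x` is controlled by a weighted integral
of the fractional energy over a neighbourhood of `x` of size comparable to `dist (x, ∂G)`. -/
theorem rpow_norm_average_le_lintegral_fracEnergy (n : ℕ) {s p c ε C₀ : ℝ} (hs : 0 ≤ s)
    (hp : 1 ≤ p) (hc : 1 ≤ c) (hε : 0 < ε) (hC₀ : 0 < C₀) (hsp : s * p ≤ n) :
    ∃ C : ℝ, 0 < C ∧ ∀ (G : Set (EuclideanSpace ℝ (Fin n))) (u : EuclideanSpace ℝ (Fin n) → ℂ),
      IsOpen G → G ≠ Set.univ → Continuous u → tsupport u ⊆ G → ∀ x ∈ G,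
      ENNReal.ofReal (C₀ * Metric.infDist x (frontier G) ^ ((n : ℝ) - s * p + 2 * ε)) ≤
        hausdorffContent ((n : ℝ) - s * p + 2 * ε) (visualBoundary G x c) →
      ENNReal.ofReal (‖⨍ y in Metric.ball x (Metric.infDist x (frontier G) / 4), u y‖ ^ p *
        Metric.infDist x (frontier G) ^ ((n : ℝ) - s * p)) ≤
      ENNReal.ofReal C *
        ∫⁻ y in G ∩ Metric.ball x ((c + 1) * Metric.infDist x (frontier G)),
          fracEnergy s p G u y *
          ENNReal.ofReal ((Metric.infDist y (frontier G) / Metric.infDist x (frontier G)) ^ ε) := by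
  obtain ⟨C, hC, h⟩ := exists_ball_average_le_lintegral_fracEnergy n hs hp hc hε
  set lam := (n : ℝ) - s * p + 2 * ε with hlam
  have hlam0 : 0 < lam := by linarith
  refine ⟨C₀⁻¹ * (6 * (3 * c)) ^ lam * C, by positivity,
    fun G u hG hne hu hsupp x hx hcont => ?_⟩
  by_cases ha0 : (⨍ y in Metric.ball x (Metric.infDist x (frontier G) / 4), u y) = 0
  · rw [ha0, norm_zero, Real.zero_rpow (by linarith), zero_mul, ENNReal.ofReal_zero]
    exact zero_le
  have hx' := h G u hG hne hu hsupp x hx ha0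
  set d := Metric.infDist x (frontier G) with hd
  have hd0 : 0 < d := infDist_frontier_pos hG hx hne
  set b := ‖⨍ y in Metric.ball x (d / 4), u y‖ with hb
  have hSmeas : MeasurableSet (G ∩ Metric.ball x ((c + 1) * d)) :=
    hG.measurableSet.inter measurableSet_ball
  let μ : Measure (EuclideanSpace ℝ (Fin n)) := ENNReal.ofReal C • volume.withDensity fun y =>
    fracEnergy s p G u y * ENNReal.ofReal ((Metric.infDist y (frontier G) / d) ^ ε)
  have hμ : ∀ T, MeasurableSet T → μ T = ENNReal.ofReal C * ∫⁻ y in T, fracEnergy s p G u y *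
      ENNReal.ofReal ((Metric.infDist y (frontier G) / d) ^ ε) := fun T hT => by
    rw [Measure.smul_apply, withDensity_apply _ hT, smul_eq_mul]
  have hcov := mul_hausdorffContent_le (lam := lam) (K := 3 * c) (ρmax := d)
    (A := visualBoundary G x c) (S := G ∩ Metric.ball x ((c + 1) * d))
    (a := ENNReal.ofReal (b ^ p * d ^ (-(2 * ε)))) hlam0 (by linarith) μ ?_
  · rw [hμ _ hSmeas] at hcov
    have h1 := (mul_le_mul_right hcont _).trans hcov
    rw [← ENNReal.ofReal_mul (by positivity)] at h1
    rw [ENNReal.ofReal_mul (p := C₀⁻¹ * (6 * (3 * c)) ^ lam) (by positivity),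
      ENNReal.ofReal_mul (p := C₀⁻¹) (by positivity), mul_assoc, mul_assoc]
    refine le_trans (le_of_eq ?_) (mul_le_mul_right h1 _)
    rw [← ENNReal.ofReal_mul (by positivity)]
    congr 1
    have : d ^ lam = d ^ ((n : ℝ) - s * p) * d ^ (2 * ε) := Real.rpow_add hd0 _ _
    rw [this, Real.rpow_neg hd0.le]
    have := Real.rpow_pos_of_pos hd0 (2 * ε)
    field_simp
  · intro ξ hξ
    obtain ⟨z, ρ, hρ0, hρd, hzξ, hzx, hzG, hzd, hle⟩ := hx' ξ hξ
    refine ⟨z, ρ, hρ0, hρd, hzξ, Set.subset_inter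
      (ball_subset_of_le_infDist_frontier hzG (by linarith))
      (Metric.ball_subset_ball' (by linarith)), ?_⟩
    rw [hμ _ measurableSet_ball]
    refine le_trans (le_of_eq ?_) hle
    rw [← ENNReal.ofReal_mul (by positivity)]
    congr 1
    have h1 : ρ ^ lam = ρ ^ ((n : ℝ) - s * p) * ρ ^ (2 * ε) := Real.rpow_add hρ0 _ _
    rw [h1, Real.rpow_neg hd0.le, Real.div_rpow hρ0.le hd0.le]
    ring

end Chaining

/-! ### The pointwise estimate and its integration -/

section Hardy

open MeasureTheory

/-- The pointwise estimate behind the Hardy inequality. The last integral has a kernel in `(x, y)`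
whose integral over `x` is bounded uniformly in `y`. -/
theorem rpow_norm_div_infDist_le (n : ℕ) {s p c ε C₀ : ℝ} (hs : 0 ≤ s) (hp : 1 ≤ p)
    (hc : 1 ≤ c) (hε : 0 < ε) (hC₀ : 0 < C₀) (hsp : s * p ≤ n) :
    ∃ C : ℝ, 0 < C ∧ ∀ (G : Set (EuclideanSpace ℝ (Fin n))) (u : EuclideanSpace ℝ (Fin n) → ℂ),
      IsOpen G → G ≠ Set.univ → Continuous u → tsupport u ⊆ G → ∀ x ∈ G,
      ENNReal.ofReal (C₀ * Metric.infDist x (frontier G) ^ ((n : ℝ) - s * p + 2 * ε)) ≤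
        hausdorffContent ((n : ℝ) - s * p + 2 * ε) (visualBoundary G x c) →
      ENNReal.ofReal (‖u x‖ ^ p / Metric.infDist x (frontier G) ^ (s * p)) ≤
      ENNReal.ofReal C * (fracEnergy s p G u x + ∫⁻ y in G, fracEnergy s p G u y *
        (ENNReal.ofReal (Metric.infDist y (frontier G) ^ ε) *
          ENNReal.ofReal ((dist x y + Metric.infDist y (frontier G)) ^ (-((n : ℝ) + ε))))) := by
  obtain ⟨C, hC, h⟩ := rpow_norm_average_le_lintegral_fracEnergy n hs hp hc hε hC₀ hsp
  set V := volume.real (Metric.ball (0 : EuclideanSpace ℝ (Fin n)) 1) with hV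
  have hV0 : 0 < V := ENNReal.toReal_pos (Metric.measure_ball_pos volume _ one_pos).ne'
    measure_ball_lt_top.ne
  have hp0 : 0 < p := by linarith
  set A₁ : ℝ := 4 ^ n / V with hA₁
  set A₂ : ℝ := C * (2 * c + 3) ^ ((n : ℝ) + ε) with hA₂
  have hA₁0 : 0 < A₁ := by positivity
  have hA₂0 : 0 < A₂ := by positivity
  refine ⟨2 ^ (p - 1) * (A₁ + A₂), by positivity, fun G u hG hne hu hsupp x hx hcont => ?_⟩
  have hav := h G u hG hne hu hsupp x hx hcont
  set d := Metric.infDist x (frontier G) with hd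
  have hd0 : 0 < d := infDist_frontier_pos hG hx hne
  have hdn : d ^ (n : ℝ) = d ^ n := Real.rpow_natCast d n
  set a := ⨍ y in Metric.ball x (d / 4), u y with ha
  set W := ∫⁻ y in G, fracEnergy s p G u y *
        (ENNReal.ofReal (Metric.infDist y (frontier G) ^ ε) *
          ENNReal.ofReal ((dist x y + Metric.infDist y (frontier G)) ^ (-((n : ℝ) + ε)))) with hW
  have hosc : ENNReal.ofReal (‖u x - a‖ ^ p / d ^ (s * p)) ≤
      ENNReal.ofReal A₁ * fracEnergy s p G u x := by
    have h1 := rpow_norm_average_sub_mul_le hu hp x (show 0 < d / 4 by positivity) (u x)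
    simp_rw [norm_sub_rev _ (u x)] at h1
    have h2 := h1.trans (setLIntegral_rpow_norm_sub_le_fracEnergy hs hp0 measurableSet_ball
      (ball_subset_of_le_infDist_frontier hx (show d / 4 ≤ d by linarith)) (y := x) (ρ := d)
      fun w hw => by
        rw [Metric.mem_ball, dist_comm] at hw
        linarith)
    rw [← ha, volume_ball_eq_ofReal_pow_mul _ (by positivity), ← hV,
      ← ENNReal.ofReal_mul (by positivity)] at h2
    have hm : 0 < ((d / 4) ^ n * V * d ^ (s * p)) := by positivity
    rw [← ENNReal.mul_le_mul_iff_right (ENNReal.ofReal_pos.2 hm).ne' ENNReal.ofReal_ne_top,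
      ← mul_assoc, ← ENNReal.ofReal_mul hm.le, ← ENNReal.ofReal_mul hm.le]
    refine le_trans (le_of_eq ?_) (h2.trans (le_of_eq ?_))
    · congr 1
      field_simp
    · congr 2
      rw [Real.rpow_add hd0, hdn, hA₁, div_pow]
      field_simp
  have hmean : ENNReal.ofReal (‖a‖ ^ p / d ^ (s * p)) ≤ ENNReal.ofReal A₂ * W := by
    have heq : ‖a‖ ^ p / d ^ (s * p) = d ^ (-(n : ℝ)) * (‖a‖ ^ p * d ^ ((n : ℝ) - s * p)) := by
      rw [Real.rpow_sub hd0, Real.rpow_neg hd0.le]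
      field_simp
    rw [heq, ENNReal.ofReal_mul (by positivity)]
    refine (mul_le_mul_right hav _).trans ?_
    rw [← mul_assoc, ← ENNReal.ofReal_mul (by positivity), hW,
      ← lintegral_const_mul' _ _ ENNReal.ofReal_ne_top,
      ← lintegral_const_mul' _ _ ENNReal.ofReal_ne_top]
    refine le_trans ?_ (lintegral_mono_set
      (s := G ∩ Metric.ball x ((c + 1) * d)) Set.inter_subset_left)
    refine setLIntegral_mono' (hG.measurableSet.inter measurableSet_ball) fun y hy => ?_
    set D := Metric.infDist y (frontier G) with hD
    have hD0 : 0 < D := infDist_frontier_pos hG hy.1 hne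
    have hyx := Metric.mem_ball.1 hy.2
    have hDd : D ≤ d + dist y x := Metric.infDist_le_infDist_add_dist
    have hle : dist x y + D ≤ (2 * c + 3) * d := by
      rw [dist_comm x y]
      linarith
    have hpos : 0 < dist x y + D := by positivity
    rw [mul_left_comm, ← ENNReal.ofReal_mul (by positivity),
      mul_left_comm (ENNReal.ofReal A₂), ← ENNReal.ofReal_mul (by positivity),
      ← ENNReal.ofReal_mul (by positivity)]
    refine mul_le_mul_right (ENNReal.ofReal_le_ofReal ?_) _
    have hker : d ^ (-((n : ℝ) + ε)) ≤
        (2 * c + 3) ^ ((n : ℝ) + ε) * (dist x y + D) ^ (-((n : ℝ) + ε)) := by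
      rw [Real.rpow_neg hd0.le, Real.rpow_neg hpos.le, ← div_eq_mul_inv, le_div_iff₀ (by positivity),
        inv_mul_eq_div, div_le_iff₀ (by positivity), ← Real.mul_rpow (by positivity) hd0.le]
      exact Real.rpow_le_rpow hpos.le hle (by positivity)
    calc d ^ (-(n : ℝ)) * C * (D / d) ^ ε = C * D ^ ε * d ^ (-((n : ℝ) + ε)) := by
          rw [Real.div_rpow hD0.le hd0.le, neg_add, Real.rpow_add hd0, Real.rpow_neg hd0.le ε]
          ring
      _ ≤ C * D ^ ε * ((2 * c + 3) ^ ((n : ℝ) + ε) * (dist x y + D) ^ (-((n : ℝ) + ε))) := by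
          gcongr
      _ = A₂ * (D ^ ε * (dist x y + D) ^ (-((n : ℝ) + ε))) := by
          rw [hA₂]
          ring
  have htri : ‖u x‖ ^ p ≤ 2 ^ (p - 1) * (‖u x - a‖ ^ p + ‖a‖ ^ p) := by
    have h1 : ‖u x‖ ≤ ‖u x - a‖ + ‖a‖ := by
      simpa using norm_add_le (u x - a) a
    refine (Real.rpow_le_rpow (norm_nonneg _) h1 hp0.le).trans ?_
    exact_mod_cast NNReal.rpow_add_le_mul_rpow_add_rpow ‖u x - a‖₊ ‖a‖₊ hp
  calc ENNReal.ofReal (‖u x‖ ^ p / d ^ (s * p))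
      ≤ ENNReal.ofReal (2 ^ (p - 1) *
          (‖u x - a‖ ^ p / d ^ (s * p) + ‖a‖ ^ p / d ^ (s * p))) := by
        refine ENNReal.ofReal_le_ofReal ?_
        rw [← add_div, ← mul_div_assoc]
        gcongr
    _ = ENNReal.ofReal (2 ^ (p - 1)) * (ENNReal.ofReal (‖u x - a‖ ^ p / d ^ (s * p)) +
          ENNReal.ofReal (‖a‖ ^ p / d ^ (s * p))) := by
        rw [ENNReal.ofReal_mul (by positivity), ENNReal.ofReal_add (by positivity) (by positivity)]
    _ ≤ ENNReal.ofReal (2 ^ (p - 1)) * (ENNReal.ofReal (A₁ + A₂) * fracEnergy s p G u x +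
          ENNReal.ofReal (A₁ + A₂) * W) := by
        gcongr
        · refine hosc.trans ?_
          gcongr
          linarith
        · refine hmean.trans ?_
          gcongr
          linarith
    _ = ENNReal.ofReal (2 ^ (p - 1) * (A₁ + A₂)) * (fracEnergy s p G u x + W) := by
        rw [← mul_add, ← mul_assoc, ← ENNReal.ofReal_mul (by positivity)]

/-- Tonelli's theorem applied to the kernel of the pointwise estimate. -/
theorem exists_lintegral_lintegral_kernel_le (n : ℕ) {ε : ℝ} (hε : 0 < ε) :
    ∃ C : ℝ, 0 < C ∧ ∀ (G : Set (EuclideanSpace ℝ (Fin n)))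
      (F : EuclideanSpace ℝ (Fin n) → ℝ≥0∞), IsOpen G → G ≠ Set.univ → Measurable F →
      ∫⁻ x in G, ∫⁻ y in G, F y * (ENNReal.ofReal (Metric.infDist y (frontier G) ^ ε) *
        ENNReal.ofReal ((dist x y + Metric.infDist y (frontier G)) ^ (-((n : ℝ) + ε)))) ≤
      ENNReal.ofReal C * ∫⁻ y in G, F y := by
  obtain ⟨C, hC, hker⟩ := exists_lintegral_dist_add_rpow_le n hε
  refine ⟨C, hC, fun G F hG hne hF => ?_⟩
  have hmeas : Measurable (Function.uncurry fun x y : EuclideanSpace ℝ (Fin n) =>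
      F y * (ENNReal.ofReal (Metric.infDist y (frontier G) ^ ε) *
        ENNReal.ofReal ((dist x y + Metric.infDist y (frontier G)) ^ (-((n : ℝ) + ε))))) := by
    have hD : Measurable fun y : EuclideanSpace ℝ (Fin n) => Metric.infDist y (frontier G) :=
      measurable_infDist
    unfold Function.uncurry
    fun_prop
  rw [lintegral_lintegral_swap hmeas.aemeasurable, ← lintegral_const_mul' _ _ ENNReal.ofReal_ne_top]
  refine setLIntegral_mono' hG.measurableSet fun y hy => ?_
  set D := Metric.infDist y (frontier G) with hD
  have hD0 : 0 < D := infDist_frontier_pos hG hy hne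
  have hmeas' : Measurable fun x : EuclideanSpace ℝ (Fin n) =>
      ENNReal.ofReal ((dist x y + D) ^ (-((n : ℝ) + ε))) := by fun_prop
  rw [lintegral_const_mul _ (hmeas'.const_mul _), lintegral_const_mul _ hmeas', mul_comm]
  gcongr
  calc ENNReal.ofReal (D ^ ε) * ∫⁻ x in G, ENNReal.ofReal ((dist x y + D) ^ (-((n : ℝ) + ε)))
      ≤ ENNReal.ofReal (D ^ ε) * ENNReal.ofReal (C * D ^ (-ε)) := by
        gcongr
        exact (setLIntegral_le_lintegral _ _).trans (hker y D hD0)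
    _ = ENNReal.ofReal C := by
        rw [← ENNReal.ofReal_mul (by positivity), Real.rpow_neg hD0.le]
        congr 1
        field_simp

end Hardy

theorem theorem4p1 (n : ℕ) (s p : ℝ) (hs0 : 0 < s) (hs1 : s < 1) (hp : 1 < p)
    (hsp : s * p < n)
    (G : Set (EuclideanSpace ℝ (Fin n))) (hG : IsOpen G) (hGne : G ≠ Set.univ)
    (lam C₀ c : ℝ) (hlam : (n : ℝ) - s * p < lam) (hlam' : lam ≤ n) (hC₀ : 0 < C₀) (hc : 1 ≤ c)
    (hvis : ∀ x ∈ G, ENNReal.ofReal (C₀ * Metric.infDist x (frontier G) ^ lam) ≤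
      hausdorffContent lam (visualBoundary G x c)) :
    AdmitsFractionalHardy s p G := by
  -- Half of the gap `lam - (n - s * p)` is spent on the decay of the increments along the chains,
  -- the other half on the weight that makes the estimates summable.
  obtain ⟨ε, hε, rfl⟩ : ∃ ε : ℝ, 0 < ε ∧ lam = (n : ℝ) - s * p + 2 * ε :=
    ⟨(lam - ((n : ℝ) - s * p)) / 2, by linarith, by ring⟩
  obtain ⟨C₁, hC₁, h₁⟩ := rpow_norm_div_infDist_le n hs0.le hp.le hc hε hC₀ hsp.le
  obtain ⟨C₂, hC₂, h₂⟩ := exists_lintegral_lintegral_kernel_le n hε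
  refine ⟨C₁ * (1 + C₂), by positivity, fun u hu _ hsupp => ?_⟩
  have hF : Measurable (fracEnergy s p G u) := measurable_fracEnergy hu.continuous
  change _ ≤ _ * ∫⁻ x in G, fracEnergy s p G u x
  refine (MeasureTheory.setLIntegral_mono' hG.measurableSet fun x hx =>
    h₁ G u hG hGne hu.continuous hsupp x hx (hvis x hx)).trans ?_
  rw [MeasureTheory.lintegral_const_mul' _ _ ENNReal.ofReal_ne_top,
    MeasureTheory.lintegral_add_left hF, ENNReal.ofReal_mul hC₁.le, mul_assoc,
    ENNReal.ofReal_add one_pos.le hC₂.le, ENNReal.ofReal_one, add_mul, one_mul]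
  gcongr
  exact h₂ G _ hG hGne hF
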